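/- Let $R$ be a commutative unital ring. All modules are $\mathbb Z$-graded $R$-modules, $\mathbb 1$ denotes an identity map, and the Koszul sign convention $(\varphi\otimes\psi)(u\otimes v)=(-1)^{|\psi||u|}\varphi(u)\otimes\psi(v)$ is used throughout. A chain complex $(V,\partial_V)$ is a graded module with a linear map $\partial_V$ of degree $-1$ and $\partial_V^2=0$. For $n\ge 2$ put $A(n)=\{(k,\ell,i): k+\ell=n+1,\ k,\ell\ge 2,\ 1\le i\le k\}$ and $B(n)=\{(k,r_1,\dots,r_k): k\ge 2,\ r_j\ge 1,\ r_1+\dots+r_k=n\}$, and $\vartheta(r_1,\dots,r_k)=\sum_{1\le i<j\le k} r_i(r_j+1)$. An $A_\infty$ algebra $(V,\partial_V,\mu_2,\mu_3,\dots)$ is a chain complex with linear maps $\mu_n:V^{\otimes n}\to V$ of degree $n-2$ ($n\ge2$) such that for all $n\ge 2$ $$\partial_V\mu_n-\sum_{u=1}^n(-1)^n\mu_n(\mathbb 1^{\otimes u-1}\otimes\partial_V\otimes\mathbb 1^{\otimes n-u})-\sum_{A(n)}(-1)^{i(\ell+1)+n}\mu_k(\mathbb 1^{\otimes i-1}\otimes\mu_\ell\otimes\mathbb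 1^{\otimes k-i})=0.$$ Let $(V,\partial_V,\mu_2,\mu_3,\dots)$ be an $A_\infty$ algebra, $(W,\partial_W)$ a chain complex, $f:V\to W$ and $g:W\to V$ chain maps (of degree $0$), and $h:V\to V$ a linear map of degree $1$ with $gf-\mathbb 1_V=\partial_V h+h\partial_V$. Define the $p$-kernels $p_n:V^{\otimes n}\to V$, $n\ge 2$, recursively by $$p_n=\sum_{B(n)}(-1)^{\vartheta(r_1,\dots,r_k)}\,\mu_k(h p_{r_1}\otimes\dots\otimes h p_{r_k}),$$ where $h p_1$ is understood to be $\mathbb 1_V$. **Theorem.** For every $n\ge 2$ the map $p_n$ has degree $n-2$ and satisfies $$\partial_V p_n-\sum_{u=1}^n(-1)^n p_n(\mathbb 1^{\otimes u-1}\otimes\partial_V\otimes\mathbb 1^{\otimes n-u})-\sum_{A(n)}(-1)^{i(\ell+1)+n}p_k(\mathbb 1^{\otimes i-1}\otimes gf p_\ell\otimes\mathbb 1^{\otimes k-i})=0.$$ Consequently, with $\nu_n=f\circ p_n\circ g^{\otimes n}$ for $n\ge 2$, $(W,\partial_W,\nu_2,\nu_3,\dots)$ is an $A_\infty$ algebra.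 -/

import Mathlib

/-! Graded modules are internally graded: a module `V` with submodules `𝒱 i`, `i : ℤ`, such that
`V = ⨁ i, 𝒱 i`.  Linear maps `V^{⊗n} → W` are multilinear maps in `n` variables. -/

namespace HomotopyTransfer

noncomputable section

/-- `k`-fold power of the grading involution: `v ↦ (-1)^{k |v|} v` on homogeneous `v`. It is the
Koszul sign that `v` picks up when a map of degree `k` is moved past it. -/
def koszulSign {R V : Type*} [CommRing R] [AddCommGroup V] [Module R V]
    (𝒱 : ℤ → Submodule R V) [DirectSum.Decomposition 𝒱] (k : ℤ) : V →ₗ[R] V :=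
  DirectSum.toModule R ℤ V (fun i => ((k * i).negOnePow : ℤ) • (𝒱 i).subtype) ∘ₗ
    (DirectSum.decomposeLinearEquiv 𝒱).toLinearMap

theorem koszulSign_of_mem {R V : Type*} [CommRing R] [AddCommGroup V] [Module R V]
    (𝒱 : ℤ → Submodule R V) [DirectSum.Decomposition 𝒱] (k i : ℤ) {v : V} (hv : v ∈ 𝒱 i) :
    koszulSign 𝒱 k v = ((k * i).negOnePow : ℤ) • v := by
  simp only [koszulSign, LinearMap.comp_apply, LinearEquiv.coe_coe,
    DirectSum.decomposeLinearEquiv_apply]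
  rw [DirectSum.decompose_of_mem 𝒱 hv]
  change DirectSum.toModule R ℤ V _ (DirectSum.lof R ℤ (fun i => 𝒱 i) i ⟨v, hv⟩) = _
  rw [DirectSum.toModule_lof]
  simp

/-- The linear map `φ` is homogeneous of degree `d`. -/
def LinHasDegree {R V W : Type*} [CommRing R] [AddCommGroup V] [Module R V]
    [AddCommGroup W] [Module R W] (𝒱 : ℤ → Submodule R V) (𝒲 : ℤ → Submodule R W)
    (d : ℤ) (φ : V →ₗ[R] W) : Prop :=
  ∀ (i : ℤ) (v : V), v ∈ 𝒱 i → φ v ∈ 𝒲 (i + d)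

/-- The map `φ : V^{⊗n} → W` is homogeneous of degree `d`. -/
def HasDegree {R V W : Type*} [CommRing R] [AddCommGroup V] [Module R V]
    [AddCommGroup W] [Module R W] (𝒱 : ℤ → Submodule R V) (𝒲 : ℤ → Submodule R W) {n : ℕ}
    (d : ℤ) (φ : MultilinearMap R (fun _ : Fin n => V) W) : Prop :=
  ∀ (a : Fin n → ℤ) (v : Fin n → V), (∀ i, v i ∈ 𝒱 (a i)) → φ v ∈ 𝒲 ((∑ i, a i) + d)

/-- `(V, ∂)` is a chain complex. -/
structure IsChainComplex {R V : Type*} [CommRing R] [AddCommGroup V] [Module R V]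
    (𝒱 : ℤ → Submodule R V) (D : V →ₗ[R] V) : Prop where
  degree : LinHasDegree 𝒱 𝒱 (-1) D
  sq_zero : ∀ v, D (D v) = 0

/-- `f` is a morphism of chain complexes `(V, DV) → (W, DW)`. -/
structure IsChainMap {R V W : Type*} [CommRing R] [AddCommGroup V] [Module R V]
    [AddCommGroup W] [Module R W] (𝒱 : ℤ → Submodule R V) (DV : V →ₗ[R] V)
    (𝒲 : ℤ → Submodule R W) (DW : W →ₗ[R] W) (f : V →ₗ[R] W) : Prop where
  degree : LinHasDegree 𝒱 𝒲 0 f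
  comm : ∀ v, f (DV v) = DW (f v)

/-- `h` is a homotopy between the endomorphism `e` and the identity: `e - 1 = ∂ h + h ∂`. -/
structure IsHomotopyToId {R V : Type*} [CommRing R] [AddCommGroup V] [Module R V]
    (𝒱 : ℤ → Submodule R V) (D : V →ₗ[R] V) (e h : V →ₗ[R] V) : Prop where
  degree : LinHasDegree 𝒱 𝒱 1 h
  homotopy : ∀ v, e v - v = D (h v) + h (D v)

/-- A linear map as a map `V^{⊗1} → W`. -/
def unary {R V W : Type*} [CommRing R] [AddCommGroup V] [Module R V]
    [AddCommGroup W] [Module R W] (φ : V →ₗ[R] W) : MultilinearMap R (fun _ : Fin 1 => V) W :=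
  MultilinearMap.ofSubsingleton R V W 0 φ

/-- `(1^{⊗i} ⊗ ψ ⊗ 1^{⊗(k-i-1)}) (v_0 ⊗ ⋯ ⊗ v_{n-1})`, as the tuple of its `k` tensor factors, for
`ψ : V^{⊗l} → V` of degree `d` and `k + l = n + 1`: by the Koszul convention the vectors to
the left of `ψ` pick up the sign `(-1)^{d |v_j|}`. -/
def insertAt {R V : Type*} [CommRing R] [AddCommGroup V] [Module R V]
    (𝒱 : ℤ → Submodule R V) [DirectSum.Decomposition 𝒱] {n k l : ℕ} (hkl : k + l = n + 1)
    (i : Fin k) (d : ℤ) (ψ : MultilinearMap R (fun _ : Fin l => V) V) (v : Fin n → V) :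
    Fin k → V := fun j =>
  if hlt : j < i then koszulSign 𝒱 d (v ⟨j, by have := i.2; omega⟩)
  else if heq : j = i then ψ (fun t => v ⟨i + t, by have := i.2; have := t.2; omega⟩)
  else v ⟨j + l - 1, by have := j.2; have := i.2; omega⟩

/-- The index set of pairs `(k, l)` with `k, l ≥ 2` and `k + l = n + 1`. -/
abbrev APairs (n : ℕ) : Type :=
  {x : Fin (n + 1) × Fin (n + 1) //
    2 ≤ (x.1 : ℕ) ∧ 2 ≤ (x.2 : ℕ) ∧ (x.1 : ℕ) + (x.2 : ℕ) = n + 1}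

/-- The expression
`∂ φ_n - ∑_{u=1}^n (-1)^n φ_n (1^{⊗(u-1)} ⊗ ∂ ⊗ 1^{⊗(n-u)})
  - ∑_{k+l=n+1, k,l≥2, 1≤i≤k} (-1)^{i(l+1)+n} φ_k (1^{⊗(i-1)} ⊗ (e ∘ φ_l) ⊗ 1^{⊗(k-i)})`
evaluated at `v_0 ⊗ ⋯ ⊗ v_{n-1}`, where `∂` has degree `-1` and `e ∘ φ_l` has degree `l - 2`.
The summation indices `u`, `i` start at `0` in the code. -/
def stasheffDefect {R V : Type*} [CommRing R] [AddCommGroup V] [Module R V]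
    (𝒱 : ℤ → Submodule R V) [DirectSum.Decomposition 𝒱] (D e : V →ₗ[R] V)
    (φ : (n : ℕ) → MultilinearMap R (fun _ : Fin n => V) V) (n : ℕ) (v : Fin n → V) : V :=
  D (φ n v)
    - ∑ u : Fin n, (-1 : ℤ) ^ n • φ n (insertAt 𝒱 rfl u (-1) (unary D) v)
    - ∑ x : APairs n, ∑ i : Fin (x.1.1 : ℕ),
        (-1 : ℤ) ^ (((i : ℕ) + 1) * ((x.1.2 : ℕ) + 1) + n) •
          φ (x.1.1 : ℕ) (insertAt 𝒱 x.2.2.2 i (((x.1.2 : ℕ) : ℤ) - 2)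
            (e.compMultilinearMap (φ (x.1.2 : ℕ))) v)

/-- `(V, ∂, μ_2, μ_3, …)` is an `A_∞` algebra. The components `μ 0` and `μ 1` are not used. -/
structure IsAInfinityAlgebra {R V : Type*} [CommRing R] [AddCommGroup V] [Module R V]
    (𝒱 : ℤ → Submodule R V) [DirectSum.Decomposition 𝒱] (D : V →ₗ[R] V)
    (μ : (n : ℕ) → MultilinearMap R (fun _ : Fin n => V) V) : Prop where
  complex : IsChainComplex 𝒱 D
  degree : ∀ n : ℕ, 2 ≤ n → HasDegree 𝒱 𝒱 ((n : ℤ) - 2) (μ n)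
  relation : ∀ n : ℕ, 2 ≤ n → ∀ v : Fin n → V, stasheffDefect 𝒱 D LinearMap.id μ n v = 0

/-- `(ψ_1 ⊗ ⋯ ⊗ ψ_k) (v_0 ⊗ ⋯ ⊗ v_{n-1})`, as the tuple of its `k` tensor factors, where
`ψ_i : V^{⊗r_i} → V` has degree `d_i` and `n = r_1 + ⋯ + r_k`: by the Koszul convention
the vectors in the `i`-th block pick up the signs of all `ψ_j` with `i < j`. -/
def koszulTensor {R V : Type*} [CommRing R] [AddCommGroup V] [Module R V]
    (𝒱 : ℤ → Submodule R V) [DirectSum.Decomposition 𝒱] {n : ℕ} (c : Composition n)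
    (d : Fin c.length → ℤ)
    (ψ : (i : Fin c.length) → MultilinearMap R (fun _ : Fin (c.blocksFun i) => V) V)
    (v : Fin n → V) : Fin c.length → V := fun i =>
  ψ i (fun t => koszulSign 𝒱 (∑ j ∈ Finset.Ioi i, d j) (v (c.embedding i t)))

theorem koszulTensor_update {R V : Type*} [CommRing R] [AddCommGroup V] [Module R V]
    (𝒱 : ℤ → Submodule R V) [DirectSum.Decomposition 𝒱] {n : ℕ} (c : Composition n)
    (d : Fin c.length → ℤ)
    (ψ : (i : Fin c.length) → MultilinearMap R (fun _ : Fin (c.blocksFun i) => V) V)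
    (v : Fin n → V) (m : Fin n) (z : V) :
    koszulTensor 𝒱 c d ψ (Function.update v m z) =
      Function.update (koszulTensor 𝒱 c d ψ v) (c.index m)
        (ψ (c.index m) (Function.update
          (fun t => koszulSign 𝒱 (∑ j ∈ Finset.Ioi (c.index m), d j)
            (v (c.embedding (c.index m) t)))
          (c.invEmbedding m) (koszulSign 𝒱 (∑ j ∈ Finset.Ioi (c.index m), d j) z))) := by
  funext k
  by_cases hk : k = c.index m
  · subst hk
    rw [Function.update_self]
    unfold koszulTensor
    congr 1
    funext t
    by_cases ht : t = c.invEmbedding m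
    · subst ht
      rw [Function.update_self, c.embedding_comp_inv, Function.update_self]
    · rw [Function.update_of_ne ht, Function.update_of_ne]
      intro h
      apply ht
      apply (c.embedding (c.index m)).injective
      rw [h, c.embedding_comp_inv]
  · rw [Function.update_of_ne hk]
    unfold koszulTensor
    congr 1
    funext t
    rw [Function.update_of_ne]
    intro h
    apply hk
    rw [← h, c.index_embedding]

/-- The map `φ ∘ (ψ_1 ⊗ ⋯ ⊗ ψ_k) : V^{⊗n} → V`. -/
def compTensor {R V : Type*} [CommRing R] [AddCommGroup V] [Module R V]
    (𝒱 : ℤ → Submodule R V) [DirectSum.Decomposition 𝒱] {n : ℕ} (c : Composition n)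
    (φ : MultilinearMap R (fun _ : Fin c.length => V) V) (d : Fin c.length → ℤ)
    (ψ : (i : Fin c.length) → MultilinearMap R (fun _ : Fin (c.blocksFun i) => V) V) :
    MultilinearMap R (fun _ : Fin n => V) V :=
  MultilinearMap.mk' (fun v => φ (koszulTensor 𝒱 c d ψ v))
    (fun v i x y => by simp only [koszulTensor_update, map_add, MultilinearMap.map_update_add])
    (fun v i a x => by simp only [koszulTensor_update, map_smul, MultilinearMap.map_update_smul])

/-- The map `h ∘ p_r`, with the convention that it means the identity of `V` for `r = 1`. -/
def homotopyKernel {R V : Type*} [CommRing R] [AddCommGroup V] [Module R V] (h : V →ₗ[R] V) :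
    (r : ℕ) → MultilinearMap R (fun _ : Fin r => V) V → MultilinearMap R (fun _ : Fin r => V) V
  | 1, _ => unary LinearMap.id
  | _, p => h.compMultilinearMap p

/-- `ϑ(r_1, …, r_k) = ∑_{i < j} r_i (r_j + 1)`. -/
def theta {n : ℕ} (c : Composition n) : ℕ :=
  ∑ i : Fin c.length, ∑ j ∈ Finset.Ioi i, c.blocksFun i * (c.blocksFun j + 1)

theorem blocksFun_lt {n : ℕ} (c : Composition n) (hc : 2 ≤ c.length) (i : Fin c.length) :
    c.blocksFun i < n := by
  have hn : 0 < n := lt_of_lt_of_le (by omega) (hc.trans c.length_le)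
  refine (Composition.ne_single_iff hn).1 ?_ i
  rintro rfl
  simp at hc

/-- The `p`-kernels
`p_n = ∑_{k ≥ 2, r_1 + ⋯ + r_k = n} (-1)^{ϑ(r_1, …, r_k)} μ_k (h p_{r_1} ⊗ ⋯ ⊗ h p_{r_k})`,
`n ≥ 2`, where `h p_1` means the identity and `h p_r` has degree `r - 1`. -/
def pKernel {R V : Type*} [CommRing R] [AddCommGroup V] [Module R V]
    (𝒱 : ℤ → Submodule R V) [DirectSum.Decomposition 𝒱]
    (μ : (n : ℕ) → MultilinearMap R (fun _ : Fin n => V) V) (h : V →ₗ[R] V) (n : ℕ) :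
    MultilinearMap R (fun _ : Fin n => V) V :=
  ∑ c : {c : Composition n // 2 ≤ c.length},
    (-1 : ℤ) ^ theta c.1 • compTensor 𝒱 c.1 (μ c.1.length)
      (fun i => (c.1.blocksFun i : ℤ) - 1)
      (fun i => homotopyKernel h (c.1.blocksFun i) (pKernel 𝒱 μ h (c.1.blocksFun i)))
termination_by n
decreasing_by exact blocksFun_lt c.1 c.2 i

/-- The transferred operations `ν_n = f ∘ p_n ∘ g^{⊗n}`. -/
def transferred {R V W : Type*} [CommRing R] [AddCommGroup V] [Module R V]
    [AddCommGroup W] [Module R W] (𝒱 : ℤ → Submodule R V) [DirectSum.Decomposition 𝒱]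
    (μ : (n : ℕ) → MultilinearMap R (fun _ : Fin n => V) V) (h : V →ₗ[R] V)
    (f : V →ₗ[R] W) (g : W →ₗ[R] V) (n : ℕ) : MultilinearMap R (fun _ : Fin n => W) W :=
  f.compMultilinearMap ((pKernel 𝒱 μ h n).compLinearMap (fun _ => g))

end

end HomotopyTransfer

/-!
The signs disappear on the bar construction. Let `s` be the suspension and let words in the letters
of `V` stand for the elements of the tensor coalgebra of `sV`. The operations `μ_n` become a
functional `β` on words (`suspend`), and the Stasheff relations say that the coderivation `b̂` with
corestriction `b = ∂ + β` satisfies `∂ β + β ∘ b̂ = 0` (`suspSign_smul_stasheffDefect`). The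
`p`-kernels become a functional `P`, and the sign `(-1)^ϑ` in their recursion is exactly the one
absorbed by the suspension, so that `P = β ∘ F̂`, where `F̂` is the coalgebra morphism with
corestriction `F = 1 + h P` (`suspend_pKernel`).

The relation to be shown is `X := ∂ P + P ∘ q̂ = 0`, where `q̂` is the coderivation with
corestriction `q = ∂ + g f P`. From `g f - 1 = ∂ h + h ∂` one computes that `F ∘ q̂ - b ∘ F̂ = h X`.
If `X` vanishes on all words shorter than `L`, then `F̂ q̂ L` and `b̂ F̂ L` have the same components
of word length at least two (`precompCoder_precompHom`). As `β` vanishes on words of length one,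
this gives `X L = ((∂ β + β ∘ b̂) ∘ F̂) L = 0`, and `X = 0` by induction (`bar_transfer`).

Elements of the tensor coalgebra are never formed: `F̂`, `q̂` and `b̂` act by precomposition on
functionals `List V → M`, which need only be additive in each letter.

The transferred operations `f p_n g^{⊗n}` satisfy their relations because the Stasheff defect of
`f p_n g^{⊗n}` is `f` applied to the defect of `p_n` at `g^{⊗n}` (`stasheffDefect_transferred`).
-/

namespace HomotopyTransfer

/-! ### Functionals on words -/

section Words

variable {V M N : Type*} [AddCommGroup M] [AddCommGroup N]

/-- The sum of `Θ A B` over all ways to write the word `L` as `A ++ B` with `A` nonempty. -/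
def prefixSum (Θ : List V → List V → M) (L : List V) : M :=
  ∑ i ∈ Finset.range L.length, Θ (L.take (i + 1)) (L.drop (i + 1))

@[simp] theorem prefixSum_nil (Θ : List V → List V → M) : prefixSum Θ [] = 0 := by
  simp [prefixSum]

theorem prefixSum_cons (Θ : List V → List V → M) (x : V) (L : List V) :
    prefixSum Θ (x :: L) = Θ [x] L + prefixSum (fun A B => Θ (x :: A) B) L := by
  simp only [prefixSum, List.length_cons]
  rw [Finset.sum_range_succ', add_comm]
  simp

theorem prefixSum_congr {Θ Θ' : List V → List V → M} {L : List V}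
    (hΘ : ∀ A B, A ≠ [] → A ++ B = L → Θ A B = Θ' A B) : prefixSum Θ L = prefixSum Θ' L := by
  refine Finset.sum_congr rfl fun i hi => hΘ _ _ ?_ (List.take_append_drop _ _)
  rintro h0
  have := congrArg List.length h0
  simp at this hi
  simp [this] at hi

theorem prefixSum_add (Θ Θ' : List V → List V → M) (L : List V) :
    prefixSum (fun A B => Θ A B + Θ' A B) L = prefixSum Θ L + prefixSum Θ' L :=
  Finset.sum_add_distrib

theorem prefixSum_map (D : M →+ N) (Θ : List V → List V → M) (L : List V) :
    prefixSum (fun A B => D (Θ A B)) L = D (prefixSum Θ L) :=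
  (map_sum D _ _).symm

/-- Coassociativity of deconcatenation. -/
theorem prefixSum_prefixSum (Ξ : List V → List V → List V → M) (L : List V) :
    prefixSum (fun A C => prefixSum (fun A B => Ξ A B C) A) L =
      prefixSum (fun A C => Ξ A [] C + prefixSum (fun B C => Ξ A B C) C) L := by
  induction L generalizing Ξ with
  | nil => simp
  | cons x L ih =>
    simp only [prefixSum_cons, prefixSum_nil, add_zero]
    rw [prefixSum_add, ih]
    abel

/-- The functional `Φ ∘ F̂`, where `F̂` is the morphism of tensor coalgebras with corestriction `F`:
its value at a word `L` is the sum of `Φ [F L₁, …, F Lₖ]` over all ways to cut `L` into nonempty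
words `L₁, …, Lₖ`. -/
def precompHom (F : List V → V) (Φ : List V → M) : List V → M
  | [] => Φ []
  | x :: L => ∑ i ∈ Finset.range (L.length + 1),
      precompHom F (fun K => Φ (F (x :: L.take i) :: K)) (L.drop i)
termination_by L => L.length
decreasing_by simp

@[simp] theorem precompHom_nil (F : List V → V) (Φ : List V → M) :
    precompHom F Φ [] = Φ [] := by
  rw [precompHom.eq_1]

theorem precompHom_eq_prefixSum (F : List V → V) (Φ : List V → M) {L : List V} (hL : L ≠ []) :
    precompHom F Φ L =
      prefixSum (fun A B => precompHom F (fun K => Φ (F A :: K)) B) L := by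
  cases L with
  | nil => exact absurd rfl hL
  | cons x L =>
    rw [precompHom.eq_2, prefixSum]
    simp

theorem precompHom_congr (F : List V → V) {Φ Ψ : List V → M} (hΦ : ∀ K, Φ K = Ψ K) (L : List V) :
    precompHom F Φ L = precompHom F Ψ L := by
  rw [funext hΦ]

/-- The words `[F L₁, …, F Lₖ]` that occur in `F̂ L` are nonempty when `L` is. -/
theorem precompHom_congr_of_ne_nil (F : List V → V) {Φ Ψ : List V → M}
    (hΦ : ∀ K, K ≠ [] → Φ K = Ψ K) {L : List V} (hL : L ≠ []) :
    precompHom F Φ L = precompHom F Ψ L := by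
  rw [precompHom_eq_prefixSum _ _ hL, precompHom_eq_prefixSum _ _ hL]
  simp [hΦ]

theorem precompHom_add (F : List V → V) (Φ Ψ : List V → M) (L : List V) :
    precompHom F (fun K => Φ K + Ψ K) L = precompHom F Φ L + precompHom F Ψ L := by
  induction hn : L.length using Nat.strong_induction_on generalizing L Φ Ψ with
  | _ n ih =>
    subst hn
    cases L with
    | nil => simp
    | cons x L =>
      simp only [precompHom.eq_2]
      rw [← Finset.sum_add_distrib]
      refine Finset.sum_congr rfl fun i _ => ih _ ?_ _ _ _ rfl
      simp

theorem precompHom_map (F : List V → V) (D : M →+ N) (Φ : List V → M) (L : List V) :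
    precompHom F (fun K => D (Φ K)) L = D (precompHom F Φ L) := by
  induction hn : L.length using Nat.strong_induction_on generalizing L Φ with
  | _ n ih =>
    subst hn
    cases L with
    | nil => simp
    | cons x L =>
      simp only [precompHom.eq_2]
      rw [map_sum]
      refine Finset.sum_congr rfl fun i _ => ih _ ?_ _ _ rfl
      simp

theorem length_lt_of_append_eq {A B L : List V} (hA : A ≠ []) (h : A ++ B = L) :
    B.length < L.length := by
  have := List.length_pos_iff.2 hA
  rw [← h]; simp; omega

/-- `F̂` is compatible with deconcatenation. -/
theorem precompHom_prefixSum (F : List V → V) (Θ : List V → List V → M) (L : List V) :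
    precompHom F (prefixSum Θ) L =
      prefixSum (fun A B => precompHom F (fun A' => precompHom F (Θ A') B) A) L := by
  induction hn : L.length using Nat.strong_induction_on generalizing L Θ with
  | _ n ih =>
    subst hn
    by_cases hL : L = []
    · subst hL; simp
    rw [precompHom_eq_prefixSum _ _ hL]
    have h1 : prefixSum (fun A B => precompHom F (fun A' => precompHom F (Θ A') B) A) L =
        prefixSum (fun A C => prefixSum (fun A B =>
          precompHom F (fun K => precompHom F (Θ (F A :: K)) C) B) A) L :=
      prefixSum_congr fun A B hA _ => precompHom_eq_prefixSum _ _ hA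
    rw [h1, prefixSum_prefixSum]
    refine prefixSum_congr fun A B hA hAB => ?_
    simp only [prefixSum_cons, precompHom_nil]
    rw [precompHom_add, ih _ (length_lt_of_append_eq hA hAB) _ _ rfl]

/-- The functional `Φ ∘ q̂`, where `q̂` is the coderivation of the tensor coalgebra with
corestriction `q`: its value at a word `L` is the sum of `Φ (σ A ++ [q B] ++ C)` over all ways to
write `L` as `A ++ B ++ C` with `B` nonempty. The map `σ` encodes the Koszul sign of moving `q` past
a letter. -/
def precompCoder (σ : V → V) (q : List V → V) (Φ : List V → M) : List V → M
  | [] => 0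
  | x :: L => precompCoder σ q (fun K => Φ (σ x :: K)) L +
      prefixSum (fun A B => Φ (q A :: B)) (x :: L)

/-- The words `σ A ++ [q B] ++ C` that occur in `q̂ L` are nonempty. -/
theorem precompCoder_congr (σ : V → V) (q : List V → V) {Φ Ψ : List V → M}
    (h : ∀ K, K ≠ [] → Φ K = Ψ K) (L : List V) :
    precompCoder σ q Φ L = precompCoder σ q Ψ L := by
  induction L generalizing Φ Ψ with
  | nil => rfl
  | cons x L ih => simp only [precompCoder]; rw [ih (Ψ := fun K => Ψ (σ x :: K))] <;> simp [h]

theorem precompCoder_add (σ : V → V) (q : List V → V) (Φ Ψ : List V → M) (L : List V) :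
    precompCoder σ q (fun K => Φ K + Ψ K) L =
      precompCoder σ q Φ L + precompCoder σ q Ψ L := by
  induction L generalizing Φ Ψ with
  | nil => simp [precompCoder]
  | cons x L ih => simp only [precompCoder, ih, prefixSum_add]; abel

theorem precompCoder_map (σ : V → V) (q : List V → V) (D : M →+ N) (Φ : List V → M)
    (L : List V) :
    precompCoder σ q (fun K => D (Φ K)) L = D (precompCoder σ q Φ L) := by
  induction L generalizing Φ with
  | nil => simp [precompCoder]
  | cons x L ih => simp only [precompCoder, ih, prefixSum_map, map_add]

/-- `q̂` is a coderivation with respect to deconcatenation. -/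
theorem precompCoder_prefixSum (σ : V → V) (q : List V → V) (Θ : List V → List V → M)
    (L : List V) :
    precompCoder σ q (prefixSum Θ) L =
      prefixSum (fun A B => precompCoder σ q (Θ (A.map σ)) B) L +
        prefixSum (fun A B => precompCoder σ q (fun A' => Θ A' B) A) L := by
  induction L generalizing Θ with
  | nil => simp [precompCoder]
  | cons x L ih =>
    have h1 : prefixSum (fun A B => prefixSum Θ (q A :: B)) (x :: L) =
        prefixSum (fun A C => prefixSum (fun A B => Θ (q A :: B) C) A) (x :: L) := by
      rw [prefixSum_prefixSum]
      simp only [prefixSum_cons]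
    rw [precompCoder, h1]
    simp only [prefixSum_cons, precompCoder, prefixSum_nil, add_zero, zero_add]
    rw [precompCoder_add, ih, prefixSum_add]
    simp only [List.map_cons, List.map_nil, prefixSum_add]
    abel

/-- `Φ ∘ q̂` as a sum over the length `l + 1` and the position `i` of the subword to which `q` is
applied. -/
theorem precompCoder_eq_sum (σ : V → V) (q : List V → V)
    (Φ : List V → M) (L : List V) :
    precompCoder σ q Φ L = ∑ l ∈ Finset.range L.length, ∑ i ∈ Finset.range (L.length - l),
      Φ ((L.take i).map σ ++ q ((L.drop i).take (l + 1)) :: (L.drop i).drop (l + 1)) := by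
  have h : precompCoder σ q Φ L = ∑ i ∈ Finset.range L.length, ∑ l ∈ Finset.range (L.length - i),
      Φ ((L.take i).map σ ++ q ((L.drop i).take (l + 1)) :: (L.drop i).drop (l + 1)) := by
    induction L generalizing Φ with
    | nil => simp [precompCoder]
    | cons x L ih =>
      rw [precompCoder, ih, List.length_cons, Finset.sum_range_succ']
      simp [prefixSum]
  rw [h]
  exact Finset.sum_comm' fun i l => by simp only [Finset.mem_range]; omega

variable [AddCommGroup V]

/-- `Φ` is additive in each letter. -/
def IsMultiadditive (Φ : List V → M) : Prop :=
  ∀ A x y B, Φ (A ++ (x + y) :: B) = Φ (A ++ x :: B) + Φ (A ++ y :: B)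

theorem IsMultiadditive.cons {Φ : List V → M} (hΦ : IsMultiadditive Φ) (x : V) :
    IsMultiadditive (fun K => Φ (x :: K)) :=
  fun A y z B => hΦ (x :: A) y z B

/-- If the corestrictions of `F̂ ∘ q̂` and `b̂ ∘ F̂` agree on the nonempty subwords of `L`, then
`F̂ (q̂ L) = b̂ (F̂ L)`. For the word `L` itself agreement is only required after applying `Φ` to
one-letter words, so it is no condition at all if `Φ` vanishes there. -/
theorem precompCoder_precompHom (σ : V → V) (F q b : List V → V) (Φ : List V → M)
    (hΦ : IsMultiadditive Φ) (hF : ∀ A, F (A.map σ) = σ (F A)) (L : List V)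
    (hlt : ∀ A, A ≠ [] → A.length < L.length → precompCoder σ q F A = precompHom F b A)
    (hL : Φ [precompCoder σ q F L] = Φ [precompHom F b L]) :
    precompCoder σ q (precompHom F Φ) L = precompHom F (precompCoder σ b Φ) L := by
  induction hn : L.length using Nat.strong_induction_on generalizing L Φ with
  | _ n ih =>
    subst hn
    by_cases hL0 : L = []
    · subst hL0; simp [precompCoder]
    -- additivity in the first letter lets `F ∘ q̂` and `b ∘ F̂` be evaluated inside `Φ`
    have hG : ∀ B, ∃ G : V →+ M, ∀ y, G y = precompHom F (fun K => Φ (y :: K)) B := fun B =>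
      ⟨AddMonoidHom.mk' (fun y => precompHom F (fun K => Φ (y :: K)) B) fun y z => by
        rw [← precompHom_add]
        exact precompHom_congr _ (fun K => hΦ [] y z K) _, fun _ => rfl⟩
    choose G hG using hG
    have h1 : precompCoder σ q (precompHom F Φ) L =
        prefixSum (fun A B => precompCoder σ q
          (precompHom F (fun K => Φ (F (A.map σ) :: K))) B) L +
        prefixSum (fun A B => G B (precompCoder σ q F A)) L := by
      rw [precompCoder_congr σ q (fun K hK => precompHom_eq_prefixSum F Φ hK),
        precompCoder_prefixSum]
      congr 1
      simp only [← hG, precompCoder_map]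
    have h2 : precompHom F (precompCoder σ b Φ) L =
        prefixSum (fun A B => precompHom F
          (precompCoder σ b (fun K => Φ (σ (F A) :: K))) B) L +
        prefixSum (fun A B => G B (precompHom F b A)) L := by
      -- the terms in which `b` is applied to an initial segment of the word `F̂ L`
      have h3 : prefixSum (fun A B => G B (precompHom F b A)) L =
          precompHom F (prefixSum fun A B => Φ (b A :: B)) L := by
        rw [precompHom_prefixSum]
        simp only [← hG, precompHom_map]
      rw [h3, precompHom_eq_prefixSum _ _ hL0, precompHom_eq_prefixSum _ _ hL0, ← prefixSum_add]
      simp only [precompCoder, precompHom_add]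
    rw [h1, h2]
    congr 1
    · refine prefixSum_congr fun A B hA hAB => ?_
      have hlen := length_lt_of_append_eq hA hAB
      rw [hF]
      by_cases hB : B = []
      · subst hB; simp [precompCoder]
      exact ih _ hlen _ (hΦ.cons _) _ (fun C hC hCB => hlt C hC (hCB.trans hlen))
        (by rw [hlt B hB hlen]) rfl
    · refine prefixSum_congr fun A B hA hAB => ?_
      by_cases hB : B = []
      · subst hB
        simp only [List.append_nil] at hAB
        subst hAB
        simpa [hG] using hL
      · rw [hlt A hA]
        rw [← hAB]
        have := List.length_pos_iff.2 hB
        simp; omega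

end Words

/-! ### Homotopy transfer on the bar construction -/

section Transfer

variable {V : Type*} [AddCommGroup V]

/-- The projection of the tensor coalgebra to its cogenerators: a one-letter word goes to its
letter, any other word to `0`. -/
def letter : List V → V
  | [x] => x
  | _ => 0

@[simp] theorem letter_singleton (x : V) : letter [x] = x := rfl

theorem letter_cons_of_ne_nil (x : V) {L : List V} (hL : L ≠ []) : letter (x :: L) = 0 := by
  cases L with
  | nil => exact absurd rfl hL
  | cons y L => rfl

theorem letter_of_two_le {L : List V} (hL : 2 ≤ L.length) : letter L = 0 := by
  match L, hL with
  | x :: y :: L, _ => rfl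

theorem prefixSum_eq_last {Θ : List V → List V → V} (hΘ : ∀ A B, B ≠ [] → Θ A B = 0)
    {L : List V} (hL : L ≠ []) : prefixSum Θ L = Θ L [] := by
  induction L generalizing Θ with
  | nil => exact absurd rfl hL
  | cons x L ih =>
    rw [prefixSum_cons]
    by_cases h : L = []
    · subst h; simp
    · rw [hΘ _ _ h, ih (fun A B => hΘ (x :: A) B) h, zero_add]

/-- The corestriction of `F̂` is `F`. -/
theorem precompHom_letter (F : List V → V) {L : List V} (hL : L ≠ []) :
    precompHom F letter L = F L := by
  rw [precompHom_eq_prefixSum _ _ hL, prefixSum_eq_last _ hL]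
  · simp
  · intro A B hB
    rw [precompHom_congr_of_ne_nil F (Ψ := fun _ => (0 : V →+ V) 0)
      (fun K hK => letter_cons_of_ne_nil _ hK) hB, precompHom_map]
    rfl

/-- The corestriction of `q̂` is `q`. -/
theorem precompCoder_letter (σ : V → V) (q : List V → V) {L : List V} (hL : L ≠ []) :
    precompCoder σ q letter L = q L := by
  cases L with
  | nil => exact absurd rfl hL
  | cons x L =>
    rw [precompCoder, prefixSum_eq_last (fun A B hB => letter_cons_of_ne_nil _ hB) (by simp),
      precompCoder_congr σ q (Ψ := fun _ => (0 : V →+ V) 0)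
      (fun K hK => letter_cons_of_ne_nil _ hK), precompCoder_map]
    simp

/-- The transfer theorem on the bar construction. Let `b = D + β` be the corestriction of a square
zero coderivation, `e - 1 = D h + h D`, and let `P = β ∘ F̂` with `F = 1 + h P`. Then the
corestriction `q = D + e P` satisfies `D P + P ∘ q̂ = 0`. -/
theorem bar_transfer (σ D e h : V →+ V) (β F P : List V → V) (hβ : IsMultiadditive β)
    (hβ0 : β [] = 0) (hβ1 : ∀ x, β [x] = 0)
    (hσF : ∀ A, F (A.map σ) = σ (F A))
    (hh : ∀ v, e v - v = D (h v) + h (D v))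
    (hP : ∀ L, P L = precompHom F β L)
    (hF : ∀ L, F L = letter L + h (P L))
    (hb : ∀ K, 2 ≤ K.length → D (β K) + precompCoder σ (fun K => D (letter K) + β K) β K = 0)
    (L : List V) :
    D (P L) + precompCoder σ (fun K => D (letter K) + e (P K)) P L = 0 := by
  set b : List V → V := fun K => D (letter K) + β K with hbdef
  set q : List V → V := fun K => D (letter K) + e (P K) with hqdef
  have hb' : ∀ K, D (β K) + precompCoder σ b β K = 0 := by
    intro K
    match K with
    | [] => simp [hβ0, precompCoder]
    | [x] => simp [hβ1, precompCoder, prefixSum_cons]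
    | x :: y :: K => exact hb _ (by simp)
  have hP' : P = precompHom F β := funext hP
  -- the defect of `F` being a morphism is `h` applied to the defect of `P`
  have key : ∀ A, A ≠ [] → precompCoder σ q F A - precompHom F b A =
      h (D (P A) + precompCoder σ q P A) := by
    intro A hA
    have h1 : precompCoder σ q F A = q A + h (precompCoder σ q P A) := by
      rw [precompCoder_congr σ q (fun K _ => hF K), precompCoder_add, precompCoder_letter _ _ hA,
        precompCoder_map]
    have h2 : precompHom F b A = D (F A) + P A := by
      rw [hbdef, precompHom_add, precompHom_map, precompHom_letter _ hA, ← hP]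
    rw [h1, h2, hF A, hqdef, map_add, map_add]
    have := hh (P A)
    rw [sub_eq_iff_eq_add] at this
    simp only [this]
    abel
  induction hn : L.length using Nat.strong_induction_on generalizing L with
  | _ n ih =>
    subst hn
    rw [hP', precompCoder_precompHom σ F q b β hβ hσF L, ← precompHom_map, ← precompHom_add,
      precompHom_congr F (Ψ := fun _ => (0 : V →+ V) 0) (fun K => hb' K), precompHom_map]
    · rfl
    · intro A hA hlen
      rw [← sub_eq_zero, key A hA, ih _ hlen A rfl, map_zero]
    · rw [hβ1, hβ1]

end Transfer

/-! ### Koszul signs and degrees -/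

section Grading

variable {R V W : Type*} [CommRing R] [AddCommGroup V] [Module R V]
  [AddCommGroup W] [Module R W]

theorem LinHasDegree.compMultilinearMap {U : Type*} [AddCommGroup U] [Module R U] {n : ℕ}
    {𝒰 : ℤ → Submodule R U} {𝒱 : ℤ → Submodule R V} {𝒲 : ℤ → Submodule R W} {c d e : ℤ}
    {f : V →ₗ[R] W} {φ : MultilinearMap R (fun _ : Fin n => U) V}
    (hf : LinHasDegree 𝒱 𝒲 c f) (hφ : HasDegree 𝒰 𝒱 d φ) (he : d + c = e) :
    HasDegree 𝒰 𝒲 e (f.compMultilinearMap φ) := by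
  intro a v hv
  have := hf _ _ (hφ a v hv)
  rwa [add_assoc, he] at this

theorem hasDegree_unary_id {𝒱 : ℤ → Submodule R V} :
    HasDegree 𝒱 𝒱 0 (unary (LinearMap.id : V →ₗ[R] V)) := by
  intro a v hv
  simpa [unary] using hv 0

theorem HasDegree.homotopyKernel {𝒱 : ℤ → Submodule R V} {h : V →ₗ[R] V} (hh : LinHasDegree 𝒱 𝒱 1 h)
    {r : ℕ} (hr : 1 ≤ r) {p : MultilinearMap R (fun _ : Fin r => V) V}
    (hp : 2 ≤ r → HasDegree 𝒱 𝒱 ((r : ℤ) - 2) p) :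
    HasDegree 𝒱 𝒱 ((r : ℤ) - 1) (homotopyKernel h r p) := by
  match r, hr with
  | 1, _ => simpa [HomotopyTransfer.homotopyKernel] using hasDegree_unary_id
  | r + 2, _ => exact hh.compMultilinearMap (hp (by omega)) (by push_cast; ring)

variable (𝒱 : ℤ → Submodule R V) [DirectSum.Decomposition 𝒱]
  (𝒲 : ℤ → Submodule R W) [DirectSum.Decomposition 𝒲]

theorem koszulSign_koszulSign (k l : ℤ) (v : V) :
    koszulSign 𝒱 k (koszulSign 𝒱 l v) = koszulSign 𝒱 (k + l) v := by
  induction v using DirectSum.Decomposition.inductionOn 𝒱 with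
  | zero => simp
  | @homogeneous i m =>
    rw [koszulSign_of_mem 𝒱 l i m.2, map_zsmul, koszulSign_of_mem 𝒱 k i m.2,
      koszulSign_of_mem 𝒱 _ i m.2, smul_smul, add_mul, Int.negOnePow_add, mul_comm]
    simp
  | add m m' h h' => simp only [map_add, h, h']

theorem koszulSign_congr {k l : ℤ} (h : Even (k - l)) (v : V) :
    koszulSign 𝒱 k v = koszulSign 𝒱 l v := by
  induction v using DirectSum.Decomposition.inductionOn 𝒱 with
  | zero => simp
  | @homogeneous i m =>
    rw [koszulSign_of_mem 𝒱 k i m.2, koszulSign_of_mem 𝒱 _ i m.2]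
    congr 2
    rw [Int.negOnePow_eq_iff, ← sub_mul]
    exact h.mul_right i
  | add m m' h h' => simp only [map_add, h, h']

theorem koszulSign_zero (v : V) : koszulSign 𝒱 0 v = v := by
  induction v using DirectSum.Decomposition.inductionOn 𝒱 with
  | zero => simp
  | @homogeneous i m => rw [koszulSign_of_mem 𝒱 0 i m.2]; simp
  | add m m' h h' => simp only [map_add, h, h']

variable {𝒱 𝒲}

theorem LinHasDegree.koszulSign_apply {d : ℤ} {φ : V →ₗ[R] W} (hφ : LinHasDegree 𝒱 𝒲 d φ)
    (k : ℤ) (v : V) :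
    koszulSign 𝒲 k (φ v) = ((k * d).negOnePow : ℤ) • φ (koszulSign 𝒱 k v) := by
  induction v using DirectSum.Decomposition.inductionOn 𝒱 with
  | zero => simp
  | @homogeneous i m =>
    rw [koszulSign_of_mem 𝒱 k i m.2, koszulSign_of_mem 𝒲 k _ (hφ i _ m.2), map_zsmul, smul_smul,
      mul_add, Int.negOnePow_add, mul_comm]
    simp
  | add m m' h h' => simp only [map_add, h, h', smul_add]

/-- Multilinear maps that agree on homogeneous arguments are equal. -/
theorem multilinearMap_ext_of_mem {n : ℕ} {φ ψ : MultilinearMap R (fun _ : Fin n => V) W}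
    (h : ∀ (a : Fin n → ℤ) (v : Fin n → V), (∀ i, v i ∈ 𝒱 (a i)) → φ v = ψ v) : φ = ψ := by
  classical
  ext v
  have hv : v = fun i => ∑ j ∈ (DirectSum.decompose 𝒱 (v i)).support,
      (DirectSum.decompose 𝒱 (v i) j : V) :=
    funext fun i => (DirectSum.sum_support_decompose 𝒱 (v i)).symm
  rw [hv, MultilinearMap.map_sum_finset, MultilinearMap.map_sum_finset]
  exact Finset.sum_congr rfl fun r _ => h r _ fun i => Submodule.coe_mem _

theorem HasDegree.koszulSign_apply {n : ℕ} {d : ℤ} {φ : MultilinearMap R (fun _ : Fin n => V) W}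
    (hφ : HasDegree 𝒱 𝒲 d φ) (k : ℤ) (v : Fin n → V) :
    koszulSign 𝒲 k (φ v) = ((k * d).negOnePow : ℤ) • φ (fun i => koszulSign 𝒱 k (v i)) := by
  have : (koszulSign 𝒲 k).compMultilinearMap φ =
      ((k * d).negOnePow : ℤ) • φ.compLinearMap (fun _ => koszulSign 𝒱 k) := by
    refine multilinearMap_ext_of_mem (𝒱 := 𝒱) fun a v hv => ?_
    have h1 : (fun i => koszulSign 𝒱 k (v i)) =
        fun i => ((((k * a i).negOnePow : ℤ) : R)) • v i := by
      funext i
      rw [koszulSign_of_mem 𝒱 k _ (hv i), Int.cast_smul_eq_zsmul]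
    have h2 : ∏ i, (((k * a i).negOnePow : ℤ) : R) = (((k * ∑ i, a i).negOnePow : ℤ) : R) := by
      rw [Finset.mul_sum]
      generalize (Finset.univ : Finset (Fin n)) = s
      induction s using Finset.induction_on with
      | empty => simp
      | insert i s hi ih => rw [Finset.prod_insert hi, Finset.sum_insert hi, ih,
          Int.negOnePow_add]; push_cast; rfl
    simp only [LinearMap.compMultilinearMap_apply, _root_.smul_apply,
      MultilinearMap.compLinearMap_apply]
    rw [h1, MultilinearMap.map_smul_univ, h2, Int.cast_smul_eq_zsmul,
      koszulSign_of_mem 𝒲 k _ (hφ a v hv), smul_smul, mul_add, Int.negOnePow_add, mul_comm]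
    simp
  exact congrArg (fun ψ => ψ v) this

theorem koszulSign_mem {i : ℤ} (k : ℤ) {v : V} (hv : v ∈ 𝒱 i) : koszulSign 𝒱 k v ∈ 𝒱 i := by
  rw [koszulSign_of_mem 𝒱 k i hv]
  exact zsmul_mem hv _

theorem HasDegree.compTensor {n : ℕ} (c : Composition n) {D e : ℤ} {d : Fin c.length → ℤ}
    {φ : MultilinearMap R (fun _ : Fin c.length => V) V}
    {ψ : (i : Fin c.length) → MultilinearMap R (fun _ : Fin (c.blocksFun i) => V) V}
    (hφ : HasDegree 𝒱 𝒱 D φ) (hψ : ∀ i, HasDegree 𝒱 𝒱 (d i) (ψ i)) (he : ∑ i, d i + D = e) :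
    HasDegree 𝒱 𝒱 e (compTensor 𝒱 c φ d ψ) := by
  intro a v hv
  have h1 := hφ (fun i => ∑ t, a (c.embedding i t) + d i) (koszulTensor 𝒱 c d ψ v)
    fun i => hψ i (fun t => a (c.embedding i t)) _ fun t => koszulSign_mem _ (hv _)
  have h2 : ∑ i, ∑ t, a (c.embedding i t) = ∑ j, a j := by
    rw [Finset.sum_sigma']
    exact Fintype.sum_equiv c.blocksFinEquiv _ _ fun _ => rfl
  rw [Finset.sum_add_distrib, h2, add_assoc, he] at h1
  exact h1

theorem pKernel_hasDegree {μ : (n : ℕ) → MultilinearMap R (fun _ : Fin n => V) V} {h : V →ₗ[R] V}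
    (hμ : ∀ n : ℕ, 2 ≤ n → HasDegree 𝒱 𝒱 ((n : ℤ) - 2) (μ n)) (hh : LinHasDegree 𝒱 𝒱 1 h)
    (n : ℕ) : HasDegree 𝒱 𝒱 ((n : ℤ) - 2) (pKernel 𝒱 μ h n) := by
  induction n using Nat.strong_induction_on with
  | _ n ih =>
    intro a v hv
    rw [pKernel, _root_.sum_apply]
    refine Submodule.sum_mem _ fun c _ => ?_
    rw [_root_.smul_apply]
    refine zsmul_mem (HasDegree.compTensor c.1 (hμ _ c.2) (fun i => HasDegree.homotopyKernel hh
      (c.1.one_le_blocksFun i) fun _ => ih _ (blocksFun_lt c.1 c.2 i)) ?_ a v hv) _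
    rw [Finset.sum_sub_distrib, ← Nat.cast_sum, c.1.sum_blocksFun]
    simp

end Grading

/-! ### Suspension of multilinear operations -/

section Suspension

variable {R V : Type*} [CommRing R] [AddCommGroup V] [Module R V]

/-- A family of multilinear maps as a functional on words. -/
def evalWord (φ : (n : ℕ) → MultilinearMap R (fun _ : Fin n => V) V) (L : List V) : V :=
  φ L.length L.get

theorem evalWord_eq (φ : (n : ℕ) → MultilinearMap R (fun _ : Fin n => V) V) {L : List V} {n : ℕ}
    {v : Fin n → V} (h : L = List.ofFn v) : evalWord φ L = φ n v := by
  have hn : L.length = n := by rw [h, List.length_ofFn]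
  subst hn
  unfold evalWord
  congr 1
  exact List.ofFn_injective (by rw [← h, List.ofFn_get])

/-- The words `A ++ z :: B` as updates of one tuple on an index type that does not depend on `z`. -/
theorem append_cons_eq_ofFn (A : List V) (z : V) (B : List V) :
    A ++ z :: B = List.ofFn (Function.update
      (fun i : Fin (A.length + 1 + B.length) => (A ++ 0 :: B)[(i : ℕ)]'(by
        have := i.2; simp; omega)) ⟨A.length, by omega⟩ z) := by
  apply List.ext_getElem
  · simp; omega
  intro i h1 h2
  rw [List.getElem_ofFn]
  rcases lt_trichotomy i A.length with hi | hi | hi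
  · rw [Function.update_of_ne (by simp [Fin.ext_iff]; omega)]
    simp [List.getElem_append_left, hi]
  · subst hi
    simp
  · rw [Function.update_of_ne (by simp [Fin.ext_iff]; omega)]
    rw [List.getElem_append_right hi.le, List.getElem_append_right hi.le]
    obtain ⟨j, hj⟩ := Nat.exists_eq_add_of_lt hi
    have : i - A.length = j + 1 := by omega
    simp [this]

theorem isMultiadditive_evalWord (φ : (n : ℕ) → MultilinearMap R (fun _ : Fin n => V) V) :
    IsMultiadditive (evalWord φ) := by
  intro A x y B
  rw [evalWord_eq φ (append_cons_eq_ofFn A (x + y) B), evalWord_eq φ (append_cons_eq_ofFn A x B),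
    evalWord_eq φ (append_cons_eq_ofFn A y B), MultilinearMap.map_update_add]

theorem IsMultiadditive.zsmul {M : Type*} [AddCommGroup M] {Φ : List V → M}
    (hΦ : IsMultiadditive Φ) (A : List V) (c : ℤ) (x : V) (B : List V) :
    Φ (A ++ (c • x) :: B) = c • Φ (A ++ x :: B) :=
  map_zsmul (AddMonoidHom.mk' (fun x => Φ (A ++ x :: B)) fun x y => hΦ A x y B) c x

theorem IsMultiadditive.map_neg {M : Type*} [AddCommGroup M] {Φ : List V → M}
    (hΦ : IsMultiadditive Φ) (τ : V → V) (A B : List V) :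
    Φ (A.map (fun x => -τ x) ++ B) = (-1 : ℤ) ^ A.length • Φ (A.map τ ++ B) := by
  induction A generalizing Φ with
  | nil => simp
  | cons x A ih =>
    have h1 := hΦ.zsmul [] (-1) (τ x) (A.map (fun x => -τ x) ++ B)
    simp only [List.nil_append, neg_smul, one_smul] at h1
    rw [List.map_cons, List.cons_append, h1, ih (hΦ.cons (τ x)), List.length_cons, pow_succ]
    simp

variable (𝒱 : ℤ → Submodule R V) [DirectSum.Decomposition 𝒱]

/-- The Koszul signs of `s ⊗ ⋯ ⊗ s` for the suspension `s` of degree `1`: each letter picks up one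
sign for every letter to its right. -/
def twist : List V → List V
  | [] => []
  | x :: L => koszulSign 𝒱 L.length x :: twist L

@[simp] theorem length_twist (L : List V) : (twist 𝒱 L).length = L.length := by
  induction L with
  | nil => rfl
  | cons x L ih => simp [twist, ih]

theorem exists_ofFn_eq_twist {n : ℕ} {L : List V} (hL : L.length = n) :
    ∃ w : Fin n → V, twist 𝒱 L = List.ofFn w := by
  subst hL
  refine ⟨fun t => (twist 𝒱 L).get (t.cast (length_twist 𝒱 L).symm), ?_⟩
  apply List.ext_getElem
  · simp
  · intro j _ _; simp

theorem twist_append (A B : List V) :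
    twist 𝒱 (A ++ B) = (twist 𝒱 A).map (koszulSign 𝒱 B.length) ++ twist 𝒱 B := by
  induction A with
  | nil => simp [twist]
  | cons x A ih =>
    simp only [List.cons_append, twist, List.map_cons, ih, koszulSign_koszulSign,
      List.length_append, Nat.cast_add]
    rw [add_comm]

theorem twist_map (τ : V → V) (hτ : ∀ (k : ℤ) x, koszulSign 𝒱 k (τ x) = τ (koszulSign 𝒱 k x))
    (A : List V) : twist 𝒱 (A.map τ) = (twist 𝒱 A).map τ := by
  induction A with
  | nil => simp [twist]
  | cons x A ih => simp [twist, ih, hτ]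

theorem exists_twist_eq (K : List V) : ∃ L, twist 𝒱 L = K := by
  induction K with
  | nil => exact ⟨[], rfl⟩
  | cons x K ih =>
    obtain ⟨L, rfl⟩ := ih
    refine ⟨koszulSign 𝒱 L.length x :: L, ?_⟩
    rw [twist, koszulSign_koszulSign, koszulSign_congr 𝒱 (l := 0) (by simp), koszulSign_zero]

/-- The sign `(-1)^{n(n-1)/2}` of reversing `n` symbols of odd degree. With this choice the
suspended relations and the suspended recursion for the kernels have no signs of their own. -/
def suspSign (n : ℕ) : ℤ := (-1) ^ ∑ i ∈ Finset.range n, i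

theorem suspSign_add (m n : ℕ) :
    suspSign (m + n) = suspSign m * suspSign n * (-1) ^ (m * n) := by
  induction n with
  | zero => simp [suspSign]
  | succ n ih =>
    simp only [suspSign] at ih ⊢
    rw [← add_assoc, Finset.sum_range_succ, Finset.sum_range_succ, pow_add, ih, mul_add, pow_add,
      pow_add, pow_add]
    ring

theorem suspSign_mul_self (n : ℕ) : suspSign n * suspSign n = 1 := by
  rw [suspSign, ← pow_add, Even.neg_one_pow ⟨_, rfl⟩]

@[simp] theorem suspSign_one : suspSign 1 = 1 := rfl

/-- The operation of arity at least `2` on the suspension of `V` that corresponds to `φ`, as a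
functional on words. It is `0` on words with fewer than two letters, so that the meaningless
components `φ 0` and `φ 1` are discarded. -/
def suspend (φ : (n : ℕ) → MultilinearMap R (fun _ : Fin n => V) V) (L : List V) : V :=
  if L.length < 2 then 0 else suspSign L.length • evalWord φ (twist 𝒱 L)

theorem suspend_of_lt (φ : (n : ℕ) → MultilinearMap R (fun _ : Fin n => V) V) {L : List V}
    (hL : L.length < 2) : suspend 𝒱 φ L = 0 := if_pos hL

theorem suspend_of_le (φ : (n : ℕ) → MultilinearMap R (fun _ : Fin n => V) V) {L : List V}
    (hL : 2 ≤ L.length) : suspend 𝒱 φ L = suspSign L.length • evalWord φ (twist 𝒱 L) :=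
  if_neg (by omega)

theorem isMultiadditive_suspend (φ : (n : ℕ) → MultilinearMap R (fun _ : Fin n => V) V) :
    IsMultiadditive (suspend 𝒱 φ) := by
  intro A x y B
  simp only [suspend, List.length_append, List.length_cons]
  split_ifs
  · simp
  · simp only [twist_append, twist, map_add]
    rw [isMultiadditive_evalWord, smul_add]
    simp

/-- The grading involution of the suspension. -/
def suspInvolution : V →+ V := -(koszulSign 𝒱 1).toAddMonoidHom

theorem suspInvolution_apply (x : V) : suspInvolution 𝒱 x = -koszulSign 𝒱 1 x := rfl

theorem koszulSign_suspInvolution (k : ℤ) (x : V) :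
    koszulSign 𝒱 k (suspInvolution 𝒱 x) = suspInvolution 𝒱 (koszulSign 𝒱 k x) := by
  simp only [suspInvolution_apply, map_neg, koszulSign_koszulSign, add_comm]

/-- `insertAt` in terms of words: if `v = A ++ B ++ C` and `ψ` is applied to `B`, then only `A`
picks up a sign. -/
theorem ofFn_insertAt {n k l : ℕ} (hkl : k + l = n + 1) (i : Fin k) (d : ℤ)
    (ψ : MultilinearMap R (fun _ : Fin l => V) V) (v : Fin n → V) {A B C : List V}
    (hv : List.ofFn v = A ++ (B ++ C)) (hA : A.length = i) {w : Fin l → V} (hB : B = List.ofFn w) :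
    List.ofFn (insertAt 𝒱 hkl i d ψ v) = A.map (koszulSign 𝒱 d) ++ ψ w :: C := by
  have hBl : B.length = l := by simp [hB]
  have hn : n = A.length + (B.length + C.length) := by
    have := congrArg List.length hv
    simpa using this
  have hget : ∀ (j : ℕ) (hj : j < n), v ⟨j, hj⟩ = (A ++ (B ++ C))[j]'(by simp; omega) := by
    intro j hj
    simp only [← hv, List.getElem_ofFn]
  apply List.ext_getElem
  · simp; omega
  intro j h1 h2
  rw [List.getElem_ofFn]
  unfold insertAt
  simp only [Fin.lt_def, Fin.ext_iff]
  rcases lt_trichotomy j A.length with hj | hj | hj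
  · rw [dif_pos (by omega), hget, List.getElem_append_left hj,
      List.getElem_append_left (by simpa using hj), List.getElem_map]
  · rw [dif_neg (by omega), dif_pos (by omega)]
    subst hj
    rw [List.getElem_append_right (by simp)]
    simp only [List.length_map, Nat.sub_self, List.getElem_cons_zero]
    congr 1
    funext t
    rw [hget]
    have ht := t.2
    simp only [← hA]
    rw [List.getElem_append_right (by omega), List.getElem_append_left (by omega)]
    simp [hB]
  · rw [dif_neg (by omega), dif_neg (by omega), hget, List.getElem_append_right (by omega),
      List.getElem_append_right (by omega), List.getElem_append_right (by simp; omega)]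
    obtain ⟨t, ht⟩ := Nat.exists_eq_add_of_lt hj
    have e1 : j + l - 1 - A.length - B.length = t := by omega
    have e2 : j - (A.map (koszulSign 𝒱 d)).length = t + 1 := by simp; omega
    simp only [e1, e2, List.getElem_cons_succ]

theorem coe_negOnePow_natCast (m : ℕ) : (((m : ℤ).negOnePow : ℤˣ) : ℤ) = (-1) ^ m := by
  rw [Int.negOnePow_def]; simp

/-- Suspension turns the signed insertion `φ_k (1^{⊗i} ⊗ ψ ⊗ 1^{⊗(k-i-1)})` of the Stasheff
relations into an insertion with the sign of an operation of degree `-1`. -/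
theorem suspend_insert {φ : (n : ℕ) → MultilinearMap R (fun _ : Fin n => V) V} {n k l : ℕ}
    (hkl : k + l = n + 1) (i : Fin k) (ψ : MultilinearMap R (fun _ : Fin l => V) V)
    (hψ : HasDegree 𝒱 𝒱 ((l : ℤ) - 2) ψ) (hk : 2 ≤ k) (v : Fin n → V) {A B C : List V}
    (hv : List.ofFn v = twist 𝒱 (A ++ (B ++ C))) (hA : A.length = i) {w : Fin l → V}
    (hB : twist 𝒱 B = List.ofFn w) :
    suspend 𝒱 φ (A.map (suspInvolution 𝒱) ++ (suspSign l • ψ w) :: C) =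
      -(suspSign n * (-1 : ℤ) ^ (((i : ℕ) + 1) * (l + 1) + n)) •
        φ k (insertAt 𝒱 hkl i ((l : ℤ) - 2) ψ v) := by
  have hBl : B.length = l := by
    have := congrArg List.length hB
    simpa using this
  have hn : n = A.length + (B.length + C.length) := by
    have := congrArg List.length hv
    simpa using this
  have hkC : k = A.length + (C.length + 1) := by omega
  have hv' : List.ofFn v = (twist 𝒱 A).map (koszulSign 𝒱 (B.length + C.length : ℕ)) ++
      ((twist 𝒱 B).map (koszulSign 𝒱 C.length) ++ twist 𝒱 C) := by
    rw [hv, twist_append, twist_append, List.length_append]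
  have hins := ofFn_insertAt 𝒱 hkl i ((l : ℤ) - 2) ψ v hv' (by simpa using hA)
    (w := fun t => koszulSign 𝒱 C.length (w t)) (by rw [hB, List.map_ofFn]; rfl)
  rw [← evalWord_eq φ hins.symm, suspend_of_le _ _ (by simp; omega), twist_append, twist, map_zsmul,
    hψ.koszulSign_apply, twist_map _ _ (koszulSign_suspInvolution 𝒱), List.map_map, List.map_map,
    (isMultiadditive_evalWord φ).zsmul, (isMultiadditive_evalWord φ).zsmul]
  have hfun1 : (koszulSign 𝒱 ((ψ w :: C).length : ℕ) : V → V) ∘ (suspInvolution 𝒱) =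
      fun x => -koszulSign 𝒱 C.length x := by
    funext x
    simp only [Function.comp, suspInvolution_apply, map_neg, koszulSign_koszulSign,
      List.length_cons]
    rw [koszulSign_congr 𝒱 (l := C.length)]
    exact ⟨1, by push_cast; ring⟩
  have hfun2 : (koszulSign 𝒱 ((l : ℤ) - 2) : V → V) ∘ (koszulSign 𝒱 (B.length + C.length : ℕ)) =
      fun x => koszulSign 𝒱 C.length x := by
    funext x
    simp only [Function.comp, koszulSign_koszulSign]
    rw [koszulSign_congr 𝒱 (l := C.length)]
    exact ⟨(l : ℤ) - 1, by rw [hBl]; push_cast; ring⟩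
  simp only [List.length_cons] at hfun1 ⊢
  rw [hfun1, hfun2, (isMultiadditive_evalWord φ).map_neg, smul_smul, smul_smul, smul_smul]
  congr 1
  have hpow : (((C.length * ((l : ℤ) - 2)).negOnePow : ℤˣ) : ℤ) = (-1) ^ (C.length * l) := by
    rw [← coe_negOnePow_natCast]
    congr 1
    rw [Int.negOnePow_eq_iff]
    exact ⟨-C.length, by push_cast; ring⟩
  have e1 : (A.map (suspInvolution 𝒱) ++ (suspSign l • ψ w) :: C).length =
      (A.length + C.length) + 1 := by simp; omega
  have e2 : n = (A.length + C.length) + l := by omega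
  rw [hpow, e1, suspSign_add, ← hA, length_twist]
  conv_rhs => rw [e2, suspSign_add]
  -- both signs depend only on the parities of the three lengths
  rcases Nat.even_or_odd A.length with ha | ha <;> rcases Nat.even_or_odd C.length with hc | hc <;>
    rcases Nat.even_or_odd l with hl | hl <;>
    simp [pow_add, pow_mul, ha.neg_one_pow, hc.neg_one_pow, hl.neg_one_pow]

/-- The pairs `(k, l)` with `k, l ≥ 2` and `k + l = m + 3`, indexed by `j = l - 2`. -/
theorem sum_APairs {M : Type*} [AddCommMonoid M] (m : ℕ) (f : ℕ → ℕ → M) :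
    ∑ x : APairs (m + 2), f (x.1.1 : ℕ) (x.1.2 : ℕ) =
      ∑ j ∈ Finset.range m, f (m + 1 - j) (j + 2) := by
  refine Finset.sum_bij (fun x _ => (x.1.2 : ℕ) - 2) ?_ ?_ ?_ ?_
  · intro x _
    have := x.2
    simp only [Finset.mem_range]; omega
  · rintro ⟨⟨a, b⟩, hx⟩ _ ⟨⟨a', b'⟩, hx'⟩ _ h
    simp only at hx hx' h
    simp only [Subtype.mk.injEq, Prod.mk.injEq, Fin.ext_iff]
    omega
  · intro j hj
    simp only [Finset.mem_range] at hj
    exact ⟨⟨(⟨m + 1 - j, by omega⟩, ⟨j + 2, by omega⟩), by simp; omega⟩, Finset.mem_univ _,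
      by simp⟩
  · intro x _
    have := x.2
    congr 1 <;> omega

/-- In the bar construction the Stasheff relations say that `D φ + φ ∘ q̂ = 0`, where `q̂` is the
coderivation with corestriction `D + e φ`. -/
theorem suspSign_smul_stasheffDefect {φ : (n : ℕ) → MultilinearMap R (fun _ : Fin n => V) V}
    {D e : V →ₗ[R] V} (hD : LinHasDegree 𝒱 𝒱 (-1) D) (he : LinHasDegree 𝒱 𝒱 0 e)
    (hφ : ∀ n : ℕ, 2 ≤ n → HasDegree 𝒱 𝒱 ((n : ℤ) - 2) (φ n)) {n : ℕ} (hn : 2 ≤ n)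
    {v : Fin n → V} {L : List V} (hv : List.ofFn v = twist 𝒱 L) :
    suspSign n • stasheffDefect 𝒱 D e φ n v = D (suspend 𝒱 φ L) +
      precompCoder (suspInvolution 𝒱) (fun K => D (letter K) + e (suspend 𝒱 φ K))
        (suspend 𝒱 φ) L := by
  have hL : L.length = n := by
    have := congrArg List.length hv
    simpa using this.symm
  -- the term of `φ ∘ q̂` in which `q` is applied to the `l + 1` letters from position `i` on
  set T : ℕ → ℕ → V := fun l i => suspend 𝒱 φ ((L.take i).map (suspInvolution 𝒱) ++
    (D (letter ((L.drop i).take (l + 1))) + e (suspend 𝒱 φ ((L.drop i).take (l + 1)))) ::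
      (L.drop i).drop (l + 1)) with hT
  have hsplit : ∀ i l, L = L.take i ++ ((L.drop i).take l ++ (L.drop i).drop l) := by
    intro i l; simp
  obtain ⟨m, rfl⟩ : ∃ m, n = m + 2 := ⟨n - 2, by omega⟩
  -- the terms in which `D` is inserted
  have h1 : ∀ u : Fin (m + 2), T 0 u = -(suspSign (m + 2)) • (-1 : ℤ) ^ (m + 2) •
      φ (m + 2) (insertAt 𝒱 rfl u (-1) (unary D) v) := by
    intro u
    have hlen : (L.drop u).take 1 = [L[u]] := by
      rw [List.take_one_drop_eq_of_lt_length (by omega)]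
      rfl
    have := suspend_insert 𝒱 (φ := φ) (l := 1) rfl u (unary D)
      (by
        intro a v hv
        simpa [unary] using hD _ _ (hv 0)) (by omega) v (A := L.take u) (B := (L.drop u).take 1)
      (C := (L.drop u).drop 1) (by rw [← hsplit, hv]) (by simp; omega)
      (w := fun _ => L[u]) (by simp [hlen, twist, koszulSign_zero])
    simp only [hT, zero_add, hlen, suspend_of_lt 𝒱 φ (L := [L[u]]) (by simp), letter_singleton,
      map_zero, add_zero]
    simp only [suspSign_one, one_smul] at this
    have hu : (unary D) (fun _ => L[u]) = D L[u] := rfl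
    rw [hu] at this
    rw [this, smul_smul]
    congr 1
    rw [pow_add, Even.neg_one_pow (n := ((u : ℕ) + 1) * (1 + 1)) (by simp)]
    ring
  -- the terms in which `e φ_l` with `2 ≤ l < n` is inserted
  have h2 : ∀ x : APairs (m + 2), ∀ i : Fin (x.1.1 : ℕ), T ((x.1.2 : ℕ) - 1) i =
      -(suspSign (m + 2)) • (-1 : ℤ) ^ (((i : ℕ) + 1) * ((x.1.2 : ℕ) + 1) + (m + 2)) •
          φ (x.1.1 : ℕ) (insertAt 𝒱 x.2.2.2 i (((x.1.2 : ℕ) : ℤ) - 2)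
            (e.compMultilinearMap (φ (x.1.2 : ℕ))) v) := by
    rintro ⟨⟨⟨k, hk'⟩, ⟨l, hl'⟩⟩, hk, hl, hkl⟩ i
    simp only at hk hl hkl i ⊢
    have hi := i.2
    have hlen : ((L.drop i).take l).length = l := by simp; omega
    obtain ⟨w, hw⟩ : ∃ w : Fin l → V, twist 𝒱 ((L.drop i).take l) = List.ofFn w :=
      exists_ofFn_eq_twist 𝒱 hlen
    have := suspend_insert 𝒱 (φ := φ) (l := l) hkl i (e.compMultilinearMap (φ l))
      (he.compMultilinearMap (hφ l hl) (by ring)) hk v (A := L.take i) (B := (L.drop i).take l)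
      (C := (L.drop i).drop l) (by rw [← hsplit, hv]) (by simp; omega) hw
    rw [smul_smul, neg_mul, ← this]
    have hl1 : l - 1 + 1 = l := by omega
    simp only [hT, hl1, letter_of_two_le (L := (L.drop i).take l) (by omega),
      suspend_of_le 𝒱 φ (L := (L.drop i).take l) (by omega), hlen, map_zero, zero_add,
      evalWord_eq φ hw, map_zsmul, LinearMap.compMultilinearMap_apply]
  -- the term `l = n`, in which the outer operation would be unary
  have h3 : T (m + 1) 0 = 0 := by
    simp only [hT]
    exact suspend_of_lt _ _ (by simp; omega)
  have h4 : ∑ x : APairs (m + 2), ∑ i : Fin (x.1.1 : ℕ), T ((x.1.2 : ℕ) - 1) i =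
      ∑ j ∈ Finset.range m, ∑ i ∈ Finset.range (m + 1 - j), T (j + 1) i := by
    have h (x : APairs (m + 2)) : ∑ i : Fin (x.1.1 : ℕ), T ((x.1.2 : ℕ) - 1) i =
        ∑ i ∈ Finset.range (x.1.1 : ℕ), T ((x.1.2 : ℕ) - 1) i := (Finset.sum_range _).symm
    simp only [h]
    rw [sum_APairs m (fun k l => ∑ i ∈ Finset.range k, T (l - 1) i)]
    simp
  rw [precompCoder_eq_sum]
  change _ = _ + ∑ l ∈ Finset.range L.length, ∑ i ∈ Finset.range (L.length - l), T l i
  rw [hL, Finset.sum_range_succ, Finset.sum_range_succ', show m + 2 - (m + 1) = 1 by omega,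
    Finset.sum_range_one, h3, add_zero]
  have h5 : ∀ j, m + 2 - (j + 1) = m + 1 - j := fun j => by omega
  simp only [h5, Nat.sub_zero]
  simp only [← h4, h2, ← Finset.smul_sum]
  rw [Finset.sum_range (fun i => T 0 i), Finset.sum_congr rfl fun u _ => h1 u, ← Finset.smul_sum]
  rw [suspend_of_le 𝒱 φ (by omega), evalWord_eq φ hv.symm, stasheffDefect, hL, map_zsmul]
  simp only [smul_sub, neg_smul]
  abel

end Suspension

/-! ### The recursion for the kernels in the bar construction -/

section Compositions

/-- Sum over compositions according to the first block. -/
theorem sum_composition_succ {M : Type*} [AddCommMonoid M] (n : ℕ) (f : List ℕ → M) :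
    ∑ c : Composition (n + 1), f c.blocks =
      ∑ i ∈ Finset.range (n + 1), ∑ c : Composition (n - i), f ((i + 1) :: c.blocks) := by
  rw [Finset.sum_range (fun i => ∑ c : Composition (n - i), f ((i + 1) :: c.blocks)),
    Finset.sum_sigma']
  symm
  refine Fintype.sum_bijective (fun x : Σ i : Fin (n + 1), Composition (n - i) =>
    (⟨((x.1 : ℕ) + 1) :: x.2.blocks, ?_, ?_⟩ : Composition (n + 1))) ⟨?_, ?_⟩ _ _ fun x => rfl
  · intro i hi
    rcases List.mem_cons.1 hi with rfl | hi
    · omega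
    · exact x.2.blocks_pos hi
  · have := x.1.2
    rw [List.sum_cons, x.2.blocks_sum]
    omega
  · rintro ⟨i, c⟩ ⟨j, d⟩ h
    simp only [Composition.mk.injEq, List.cons.injEq, Nat.add_right_cancel_iff] at h
    obtain ⟨h1, h2⟩ := h
    obtain rfl : i = j := Fin.ext h1
    obtain rfl : c = d := Composition.ext h2
    rfl
  · rintro ⟨blocks, hpos, hsum⟩
    cases blocks with
    | nil => simp at hsum
    | cons r rs =>
      have hr : 0 < r := hpos (by simp)
      rw [List.sum_cons] at hsum
      refine ⟨⟨⟨r - 1, by omega⟩, ⟨rs, fun hi => hpos (by simp [hi]), by simp; omega⟩⟩, ?_⟩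
      simp only [Composition.mk.injEq, List.cons.injEq, and_true]
      omega

/-- Cut the word `L` into words of lengths `rs` and apply `F` to each of them. -/
def mapBlocks {V : Type*} (F : List V → V) : List ℕ → List V → List V
  | [], _ => []
  | r :: rs, L => F (L.take r) :: mapBlocks F rs (L.drop r)

@[simp] theorem length_mapBlocks {V : Type*} (F : List V → V) (rs : List ℕ) (L : List V) :
    (mapBlocks F rs L).length = rs.length := by
  induction rs generalizing L with
  | nil => rfl
  | cons r rs ih => simp [mapBlocks, ih]

theorem precompHom_eq_sum {V M : Type*} [AddCommGroup M] (F : List V → V) (Φ : List V → M) {n : ℕ}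
    {L : List V} (hL : L.length = n) :
    precompHom F Φ L = ∑ c : Composition n, Φ (mapBlocks F c.blocks L) := by
  induction n using Nat.strong_induction_on generalizing L Φ with
  | _ n ih =>
    subst hL
    cases L with
    | nil =>
      have h (c : Composition ([] : List V).length) : Φ (mapBlocks F c.blocks []) = Φ [] := by
        rw [c.blocks_eq_nil.2 rfl]; rfl
      simp only [h, precompHom_nil, Finset.sum_const, Finset.card_univ]
      rw [composition_card]
      simp
    | cons x L =>
      rw [precompHom.eq_2]
      simp only [List.length_cons]
      rw [sum_composition_succ L.length fun rs => Φ (mapBlocks F rs (x :: L))]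
      refine Finset.sum_congr rfl fun i hi => ?_
      rw [ih (L.length - i) (by simp) _ (L := L.drop i) (by simp)]
      rfl

theorem sum_Ioi_eq_sum_drop {M : Type*} [AddCommMonoid M] {k : ℕ} (a : Fin k → M) (i : Fin k) :
    ∑ j ∈ Finset.Ioi i, a j = ((List.ofFn a).drop (i + 1)).sum := by
  induction k with
  | zero => exact i.elim0
  | succ k ih =>
    rw [List.ofFn_succ]
    refine Fin.cases ?_ (fun i => ?_) i
    · rw [Fin.sum_Ioi_zero, ← List.sum_ofFn]; rfl
    · rw [Fin.sum_Ioi_succ, ih]; rfl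

/-- The exponent `ϑ` as a function of the list of block lengths. -/
def thetaList : List ℕ → ℕ
  | [] => 0
  | r :: rs => r * (rs.sum + rs.length) + thetaList rs

theorem theta_eq_thetaList {n : ℕ} (c : Composition n) : theta c = thetaList c.blocks := by
  have h : ∀ (k : ℕ) (a : Fin k → ℕ),
      ∑ i, ∑ j ∈ Finset.Ioi i, a i * (a j + 1) = thetaList (List.ofFn a) := by
    intro k a
    induction k with
    | zero => simp [thetaList]
    | succ k ih =>
      rw [Fin.sum_univ_succ, List.ofFn_succ, thetaList, ← ih, Fin.sum_Ioi_zero]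
      simp only [Fin.sum_Ioi_succ]
      rw [← Finset.mul_sum, Finset.sum_add_distrib, List.sum_ofFn]
      simp
  rw [theta, h, c.ofFn_blocksFun]

end Compositions

section Kernels

variable {R V : Type*} [CommRing R] [AddCommGroup V] [Module R V]
  (𝒱 : ℤ → Submodule R V) [DirectSum.Decomposition 𝒱]

/-- The tensor factors of `(ψ_{r_1} ⊗ ⋯ ⊗ ψ_{r_k}) w`, where `ψ_r` has degree `r - 1`, as a
word. -/
def koszulBlocks (ψ : List V → V) : List ℕ → List V → List V
  | [], _ => []
  | r :: rs, w => ψ ((w.take r).map (koszulSign 𝒱 (rs.map fun r : ℕ => (r : ℤ) - 1).sum)) ::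
      koszulBlocks ψ rs (w.drop r)

theorem length_koszulBlocks (ψ : List V → V) (rs : List ℕ) (w : List V) :
    (koszulBlocks 𝒱 ψ rs w).length = rs.length := by
  induction rs generalizing w with
  | nil => rfl
  | cons r rs ih => simp [koszulBlocks, ih]

theorem getElem_koszulBlocks (ψ : List V → V) (rs : List ℕ) (w : List V) (i : ℕ)
    (hi : i < rs.length) :
    (koszulBlocks 𝒱 ψ rs w)[i]'(by rwa [length_koszulBlocks]) =
      ψ (((w.drop (rs.take i).sum).take rs[i]).map
        (koszulSign 𝒱 ((rs.drop (i + 1)).map fun r : ℕ => (r : ℤ) - 1).sum)) := by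
  induction rs generalizing w i with
  | nil => simp at hi
  | cons r rs ih =>
    cases i with
    | zero => simp [koszulBlocks]
    | succ i =>
      simp only [koszulBlocks, List.getElem_cons_succ, List.take_succ_cons, List.sum_cons,
        List.drop_succ_cons]
      rw [ih _ _ (by simpa using hi), List.drop_drop]

theorem ofFn_koszulTensor {n : ℕ} (c : Composition n)
    (ψ : (n : ℕ) → MultilinearMap R (fun _ : Fin n => V) V) (v : Fin n → V) :
    List.ofFn (koszulTensor 𝒱 c (fun i => (c.blocksFun i : ℤ) - 1) (fun i => ψ (c.blocksFun i)) v) =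
      koszulBlocks 𝒱 (evalWord ψ) c.blocks (List.ofFn v) := by
  apply List.ext_getElem
  · simp [length_koszulBlocks]
  intro i h1 h2
  rw [List.length_ofFn] at h1
  have hi : i < c.blocks.length := by simpa using h1
  rw [List.getElem_ofFn, getElem_koszulBlocks 𝒱 _ _ _ _ hi]
  unfold koszulTensor
  symm
  apply evalWord_eq
  have hd : List.ofFn (fun j => (c.blocksFun j : ℤ) - 1) =
      c.blocks.map fun r : ℕ => (r : ℤ) - 1 := by
    rw [← c.ofFn_blocksFun, List.map_ofFn]; rfl
  rw [sum_Ioi_eq_sum_drop, hd, ← List.map_drop]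
  have hsize := c.sizeUpTo_succ h1
  have hle := c.sizeUpTo_le (i + 1)
  apply List.ext_getElem
  · simp only [List.length_map, List.length_take, List.length_drop, List.length_ofFn]
    change min c.blocks[i] (n - c.sizeUpTo i) = c.blocks[i]
    omega
  · intro t _ ht
    simp only [List.getElem_map, List.getElem_take, List.getElem_drop, List.getElem_ofFn]
    rfl

variable (μ : (n : ℕ) → MultilinearMap R (fun _ : Fin n => V) V) (h : V →ₗ[R] V)

/-- The corestriction `1 + h P` of the morphism from the transferred to the given bar
construction, `P` being the suspension of the `p`-kernels. -/
def kernelHom (L : List V) : V := letter L + h (suspend 𝒱 (pKernel 𝒱 μ h) L)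

/-- The maps `h p_r`, with `h p_1 = 1`. -/
def homotopyKernels (r : ℕ) : MultilinearMap R (fun _ : Fin r => V) V :=
  homotopyKernel h r (pKernel 𝒱 μ h r)

variable {μ h}

/-- On nonempty words `1 + h P` is the suspension of the family `h p_r`, `r ≥ 1`, with
`h p_1 = 1`. -/
theorem kernelHom_eq {L : List V} (hL : L ≠ []) :
    kernelHom 𝒱 μ h L =
      suspSign L.length • evalWord (homotopyKernels 𝒱 μ h) (twist 𝒱 L) := by
  match L, hL with
  | [x], _ =>
    simp only [kernelHom, letter_singleton, suspend_of_lt 𝒱 _ (L := [x]) (by simp), map_zero,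
      add_zero, List.length_singleton, suspSign_one, one_smul]
    change x = koszulSign 𝒱 0 x
    rw [koszulSign_zero]
  | x :: y :: L, _ =>
    rw [kernelHom, letter_of_two_le (by simp), suspend_of_le _ _ (by simp), map_zsmul, zero_add]
    rfl

theorem homotopyKernels_hasDegree
    (hμ : ∀ n : ℕ, 2 ≤ n → HasDegree 𝒱 𝒱 ((n : ℤ) - 2) (μ n)) (hh : LinHasDegree 𝒱 𝒱 1 h)
    {r : ℕ} (hr : 1 ≤ r) : HasDegree 𝒱 𝒱 ((r : ℤ) - 1) (homotopyKernels 𝒱 μ h r) :=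
  HasDegree.homotopyKernel hh hr fun _ => pKernel_hasDegree hμ hh r

theorem koszulSign_kernelHom
    (hμ : ∀ n : ℕ, 2 ≤ n → HasDegree 𝒱 𝒱 ((n : ℤ) - 2) (μ n)) (hh : LinHasDegree 𝒱 𝒱 1 h)
    (m : ℕ) {L : List V} (hL : L ≠ []) :
    koszulSign 𝒱 m (kernelHom 𝒱 μ h L) = (suspSign L.length * (-1) ^ (m * (L.length + 1))) •
      evalWord (homotopyKernels 𝒱 μ h) ((twist 𝒱 L).map (koszulSign 𝒱 m)) := by
  obtain ⟨w, hw⟩ := exists_ofFn_eq_twist 𝒱 (L := L) rfl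
  rw [kernelHom_eq 𝒱 hL, map_zsmul, evalWord_eq _ hw,
    evalWord_eq (v := fun t => koszulSign 𝒱 m (w t)) _ (by rw [hw, List.map_ofFn]; rfl),
    (homotopyKernels_hasDegree 𝒱 hμ hh (List.length_pos_iff.2 hL)).koszulSign_apply, smul_smul,
    ← coe_negOnePow_natCast]
  congr 3
  rw [Int.negOnePow_eq_iff]
  exact ⟨-m, by push_cast; ring⟩

/-- `1 + h P` has degree `0` on the suspension. -/
theorem kernelHom_map_suspInvolution
    (hμ : ∀ n : ℕ, 2 ≤ n → HasDegree 𝒱 𝒱 ((n : ℤ) - 2) (μ n)) (hh : LinHasDegree 𝒱 𝒱 1 h)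
    (L : List V) :
    kernelHom 𝒱 μ h (L.map (suspInvolution 𝒱)) = suspInvolution 𝒱 (kernelHom 𝒱 μ h L) := by
  by_cases hL : L = []
  · subst hL
    simp [kernelHom, letter, suspend_of_lt]
  have h1 := koszulSign_kernelHom 𝒱 hμ hh 1 hL
  have h2 := (isMultiadditive_evalWord (homotopyKernels 𝒱 μ h)).map_neg
    (koszulSign 𝒱 1) (twist 𝒱 L) []
  simp only [List.append_nil, length_twist] at h2
  rw [Nat.cast_one] at h1
  rw [suspInvolution_apply, h1, kernelHom_eq 𝒱 (by simpa using hL),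
    twist_map _ _ (koszulSign_suspInvolution 𝒱), ← neg_smul, List.length_map]
  have h3 : (⇑(suspInvolution 𝒱) : V → V) = fun x => -koszulSign 𝒱 1 x := rfl
  rw [h3, h2, smul_smul]
  congr 1
  rw [one_mul, pow_succ]
  ring

/-- Suspension absorbs the sign `(-1)^ϑ` in the recursion for the `p`-kernels. -/
theorem twist_mapBlocks_kernelHom
    (hμ : ∀ n : ℕ, 2 ≤ n → HasDegree 𝒱 𝒱 ((n : ℤ) - 2) (μ n)) (hh : LinHasDegree 𝒱 𝒱 1 h)
    {Φ : List V → V} (hΦ : IsMultiadditive Φ) {rs : List ℕ} (hrs : ∀ r ∈ rs, 0 < r) {L : List V}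
    (hL : L.length = rs.sum) :
    suspSign rs.length • Φ (twist 𝒱 (mapBlocks (kernelHom 𝒱 μ h) rs L)) =
      (suspSign rs.sum * (-1 : ℤ) ^ thetaList rs) •
        Φ (koszulBlocks 𝒱 (evalWord (homotopyKernels 𝒱 μ h)) rs (twist 𝒱 L)) := by
  induction rs generalizing L Φ with
  | nil => simp [mapBlocks, koszulBlocks, twist, thetaList]
  | cons r rs ih =>
    obtain ⟨A, B, rfl, hA⟩ : ∃ A B, L = A ++ B ∧ A.length = r :=
      ⟨L.take r, L.drop r, by simp, by simp at hL ⊢; omega⟩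
    have hr : 0 < r := hrs r (by simp)
    have hA0 : A ≠ [] := List.length_pos_iff.1 (hA ▸ hr)
    have hB : B.length = rs.sum := by simp at hL; omega
    have hfun : (koszulSign 𝒱 (rs.map fun r : ℕ => (r : ℤ) - 1).sum : V → V) ∘
        (koszulSign 𝒱 B.length) = koszulSign 𝒱 rs.length := by
      funext x
      simp only [Function.comp, koszulSign_koszulSign]
      apply koszulSign_congr
      have : (rs.map fun r : ℕ => (r : ℤ) - 1).sum = (rs.sum : ℤ) - rs.length := by
        clear * -
        induction rs with
        | nil => simp
        | cons r rs ih => simp [ih]; ring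
      rw [this, hB]
      exact ⟨(rs.sum : ℤ) - rs.length, by ring⟩
    have ht : (twist 𝒱 A).map (koszulSign 𝒱 B.length) ≠ [] ∧
        ((twist 𝒱 A).map (koszulSign 𝒱 B.length)).length = r := by
      refine ⟨?_, by simpa using hA⟩
      rw [← List.length_pos_iff]; simp; omega
    have e1 : (A ++ B).take r = A := List.take_left' hA
    have e2 : (A ++ B).drop r = B := List.drop_left' hA
    rw [mapBlocks, koszulBlocks, twist_append, List.take_left' ht.2, List.drop_left' ht.2, e1, e2,
      List.map_map, hfun, twist, length_mapBlocks, koszulSign_kernelHom 𝒱 hμ hh _ hA0]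
    have h1 := hΦ.zsmul [] (suspSign A.length * (-1) ^ (rs.length * (A.length + 1)))
      (evalWord (homotopyKernels 𝒱 μ h) ((twist 𝒱 A).map (koszulSign 𝒱 rs.length)))
      (twist 𝒱 (mapBlocks (kernelHom 𝒱 μ h) rs B))
    simp only [List.nil_append] at h1
    have h2 := ih (hΦ.cons
      (evalWord (homotopyKernels 𝒱 μ h) ((twist 𝒱 A).map (koszulSign 𝒱 rs.length))))
      (fun r hr => hrs r (by simp [hr])) hB
    have hsq (m : ℕ) : (-1 : ℤ) ^ m * (-1) ^ m = 1 := by rw [← pow_add, Even.neg_one_pow ⟨m, rfl⟩]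
    have h3 : suspSign (rs.length + 1) * (suspSign A.length * (-1) ^ (rs.length * (A.length + 1))) =
        suspSign r * (-1) ^ (rs.length * r) * suspSign rs.length := by
      rw [suspSign_add, suspSign_one, hA, mul_add, pow_add, mul_one]
      linear_combination (suspSign rs.length * suspSign r * (-1) ^ (rs.length * r)) *
        hsq rs.length
    rw [h1, List.length_cons, smul_smul, h3, mul_smul, h2, smul_smul, List.sum_cons, suspSign_add,
      thetaList]
    congr 1
    rw [pow_add, mul_add, pow_add, mul_comm rs.length r]
    linear_combination -(suspSign r * suspSign rs.sum * (-1) ^ (r * rs.length) *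
      (-1) ^ thetaList rs) * hsq (r * rs.sum)

/-- In the bar construction the recursion for the `p`-kernels reads `P = β ∘ F̂`, without signs. -/
theorem suspend_pKernel
    (hμ : ∀ n : ℕ, 2 ≤ n → HasDegree 𝒱 𝒱 ((n : ℤ) - 2) (μ n)) (hh : LinHasDegree 𝒱 𝒱 1 h)
    (L : List V) :
    suspend 𝒱 (pKernel 𝒱 μ h) L = precompHom (kernelHom 𝒱 μ h) (suspend 𝒱 μ) L := by
  rw [precompHom_eq_sum _ _ rfl]
  by_cases hL : L.length < 2
  · rw [suspend_of_lt _ _ hL]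
    symm
    refine Finset.sum_eq_zero fun c _ => suspend_of_lt _ _ ?_
    have := c.length_le
    rw [length_mapBlocks, c.blocks_length]
    omega
  push Not at hL
  obtain ⟨w, hw⟩ := exists_ofFn_eq_twist 𝒱 (L := L) rfl
  have hfilter : ∑ c : Composition L.length,
      suspend 𝒱 μ (mapBlocks (kernelHom 𝒱 μ h) c.blocks L) =
      ∑ c : {c : Composition L.length // 2 ≤ c.length},
        suspend 𝒱 μ (mapBlocks (kernelHom 𝒱 μ h) c.1.blocks L) := by
    rw [← Finset.sum_subtype (Finset.univ.filter fun c : Composition L.length => 2 ≤ c.length)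
      (by simp) (fun c => suspend 𝒱 μ (mapBlocks (kernelHom 𝒱 μ h) c.blocks L)),
      Finset.sum_filter_of_ne]
    intro c _ hc
    by_contra hlt
    exact hc (suspend_of_lt _ _ (by simpa using hlt))
  rw [hfilter, suspend_of_le _ _ hL, evalWord_eq _ hw, pKernel, sum_apply, Finset.smul_sum]
  refine Finset.sum_congr rfl fun c _ => ?_
  have h1 : compTensor 𝒱 c.1 (μ c.1.length) (fun i => (c.1.blocksFun i : ℤ) - 1)
      (fun i => homotopyKernel h (c.1.blocksFun i) (pKernel 𝒱 μ h (c.1.blocksFun i))) w =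
      evalWord μ (koszulBlocks 𝒱 (evalWord (homotopyKernels 𝒱 μ h)) c.1.blocks (twist 𝒱 L)) := by
    rw [hw, ← ofFn_koszulTensor, evalWord_eq μ rfl]
    rfl
  have h2 := twist_mapBlocks_kernelHom 𝒱 hμ hh (isMultiadditive_evalWord μ)
    (fun r hr => c.1.blocks_pos hr) c.1.blocks_sum.symm
  rw [suspend_of_le _ _ (by simpa using c.2), length_mapBlocks, h2, smul_apply, h1, smul_smul,
    theta_eq_thetaList, c.1.blocks_sum]

end Kernels

/-! ### The transferred structure -/

section Main

variable {R V W : Type*} [CommRing R] [AddCommGroup V] [Module R V]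
  [AddCommGroup W] [Module R W]
  {𝒱 : ℤ → Submodule R V} [DirectSum.Decomposition 𝒱]
  {𝒲 : ℤ → Submodule R W} [DirectSum.Decomposition 𝒲]

/-- The `p`-kernels satisfy the Stasheff relations with inner operations `e ∘ p_l`. -/
theorem stasheffDefect_pKernel {D e h : V →ₗ[R] V}
    {μ : (n : ℕ) → MultilinearMap R (fun _ : Fin n => V) V} (hμ : IsAInfinityAlgebra 𝒱 D μ)
    (he : LinHasDegree 𝒱 𝒱 0 e) (hh : IsHomotopyToId 𝒱 D e h) {n : ℕ} (hn : 2 ≤ n)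
    (v : Fin n → V) : stasheffDefect 𝒱 D e (pKernel 𝒱 μ h) n v = 0 := by
  obtain ⟨L, hL⟩ := exists_twist_eq 𝒱 (List.ofFn v)
  have key := bar_transfer (suspInvolution 𝒱) D.toAddMonoidHom e.toAddMonoidHom
    h.toAddMonoidHom (suspend 𝒱 μ) (kernelHom 𝒱 μ h) (suspend 𝒱 (pKernel 𝒱 μ h))
    (isMultiadditive_suspend 𝒱 μ) (suspend_of_lt 𝒱 μ (by simp))
    (fun x => suspend_of_lt 𝒱 μ (by simp))
    (kernelHom_map_suspInvolution 𝒱 hμ.degree hh.degree) hh.homotopy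
    (suspend_pKernel 𝒱 hμ.degree hh.degree) (fun _ => rfl)
    (fun K hK => by
      obtain ⟨w, hw⟩ := exists_ofFn_eq_twist 𝒱 (L := K) rfl
      have := suspSign_smul_stasheffDefect 𝒱 (e := LinearMap.id) hμ.complex.degree
        (fun i v hv => by simpa using hv) hμ.degree hK hw.symm
      rw [hμ.relation _ hK, smul_zero] at this
      exact this.symm) L
  have h1 := suspSign_smul_stasheffDefect 𝒱 hμ.complex.degree he
    (fun n _ => pKernel_hasDegree hμ.degree hh.degree n) hn hL.symm
  have h2 : suspSign n • stasheffDefect 𝒱 D e (pKernel 𝒱 μ h) n v = 0 := h1.trans key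
  have h3 := congrArg (suspSign n • ·) h2
  simpa only [smul_smul, suspSign_mul_self, one_smul, smul_zero] using h3

/-- A map `g` of degree `0` that intertwines the inner operations `ψ` and `ψ'` commutes with their
insertion, since it preserves the Koszul signs. -/
theorem map_insertAt {g : W →ₗ[R] V} (hg : LinHasDegree 𝒲 𝒱 0 g) {n k l : ℕ} (hkl : k + l = n + 1)
    (i : Fin k) (d : ℤ) {ψ : MultilinearMap R (fun _ : Fin l => W) W}
    {ψ' : MultilinearMap R (fun _ : Fin l => V) V} (hψ : ∀ w, g (ψ w) = ψ' fun t => g (w t))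
    (w : Fin n → W) :
    (fun j => g (insertAt 𝒲 hkl i d ψ w j)) = insertAt 𝒱 hkl i d ψ' fun t => g (w t) := by
  funext j
  unfold insertAt
  split_ifs
  · rw [hg.koszulSign_apply d]
    simp
  · exact hψ _
  · rfl

theorem stasheffDefect_transferred {DV h : V →ₗ[R] V} {DW : W →ₗ[R] W} {f : V →ₗ[R] W}
    {g : W →ₗ[R] V} (hf : IsChainMap 𝒱 DV 𝒲 DW f) (hg : IsChainMap 𝒲 DW 𝒱 DV g)
    (μ : (n : ℕ) → MultilinearMap R (fun _ : Fin n => V) V) (n : ℕ) (w : Fin n → W) :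
    stasheffDefect 𝒲 DW LinearMap.id (transferred 𝒱 μ h f g) n w =
      f (stasheffDefect 𝒱 DV (g ∘ₗ f) (pKernel 𝒱 μ h) n fun t => g (w t)) := by
  have hν (k : ℕ) (x : Fin k → W) :
      transferred 𝒱 μ h f g k x = f (pKernel 𝒱 μ h k fun t => g (x t)) := rfl
  simp only [stasheffDefect, map_sub, map_sum, map_zsmul, hν, hf.comm]
  congr 1
  · congr 1
    refine Finset.sum_congr rfl fun u _ => ?_
    rw [map_insertAt hg.degree rfl u (-1) (ψ' := unary DV) fun x => hg.comm _]
  · refine Finset.sum_congr rfl fun x _ => Finset.sum_congr rfl fun i _ => ?_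
    rw [map_insertAt hg.degree x.2.2.2 i _
      (ψ' := (g ∘ₗ f).compMultilinearMap (pKernel 𝒱 μ h x.1.2)) fun y => rfl]

end Main

end HomotopyTransfer

theorem mainTheorem2 {R V W : Type*} [CommRing R] [AddCommGroup V] [Module R V]
    [AddCommGroup W] [Module R W]
    (𝒱 : ℤ → Submodule R V) [DirectSum.Decomposition 𝒱]
    (𝒲 : ℤ → Submodule R W) [DirectSum.Decomposition 𝒲]
    (DV : V →ₗ[R] V) (DW : W →ₗ[R] W)
    (μ : (n : ℕ) → MultilinearMap R (fun _ : Fin n => V) V)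
    (hμ : HomotopyTransfer.IsAInfinityAlgebra 𝒱 DV μ)
    (hW : HomotopyTransfer.IsChainComplex 𝒲 DW)
    (f : V →ₗ[R] W) (hf : HomotopyTransfer.IsChainMap 𝒱 DV 𝒲 DW f)
    (g : W →ₗ[R] V) (hg : HomotopyTransfer.IsChainMap 𝒲 DW 𝒱 DV g)
    (h : V →ₗ[R] V) (hh : HomotopyTransfer.IsHomotopyToId 𝒱 DV (g ∘ₗ f) h) :
    (∀ n : ℕ, 2 ≤ n →
      HomotopyTransfer.HasDegree 𝒱 𝒱 ((n : ℤ) - 2) (HomotopyTransfer.pKernel 𝒱 μ h n)) ∧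
    (∀ n : ℕ, 2 ≤ n → ∀ v : Fin n → V,
      HomotopyTransfer.stasheffDefect 𝒱 DV (g ∘ₗ f) (HomotopyTransfer.pKernel 𝒱 μ h) n v = 0) ∧
    HomotopyTransfer.IsAInfinityAlgebra 𝒲 DW (HomotopyTransfer.transferred 𝒱 μ h f g) := by
  have hp := HomotopyTransfer.pKernel_hasDegree hμ.degree hh.degree
  have hgf : HomotopyTransfer.LinHasDegree 𝒱 𝒱 0 (g ∘ₗ f) := fun i v hv => by
    simpa using hg.degree _ _ (hf.degree i v hv)
  have hrel : ∀ n : ℕ, 2 ≤ n → ∀ v : Fin n → V,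
      HomotopyTransfer.stasheffDefect 𝒱 DV (g ∘ₗ f) (HomotopyTransfer.pKernel 𝒱 μ h) n v = 0 :=
    fun n hn v => HomotopyTransfer.stasheffDefect_pKernel hμ hgf hh hn v
  refine ⟨fun n _ => hp n, hrel, hW, fun n _ => ?_, fun n hn w => ?_⟩
  · refine hf.degree.compMultilinearMap (fun a w hw => ?_) (add_zero _)
    exact hp n a _ fun i => by simpa using hg.degree _ _ (hw i)
  · rw [HomotopyTransfer.stasheffDefect_transferred hf hg, hrel n hn, map_zero]
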